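/- **Setting.** For $d\times d$ complex matrices let $\|\cdot\|_1$ and $\|\cdot\|_\infty$ be the trace norm and the operator norm. For quantum states $\rho,\sigma$ let $\mathrm{D}_{\chi^2}(\rho\|\sigma)=\mathrm{tr}(\sigma^{-1}(\rho-\sigma)^2)$ if $\mathrm{supp}(\rho)\subseteq\mathrm{supp}(\sigma)$ (with $\sigma^{-1}$ the inverse on the support), and $\infty$ otherwise. Let $V_1,\dots,V_{d^2}$ be Hermitian matrices that form an orthonormal basis of $\mathbb{C}^{d\times d}$ for the Hilbert–Schmidt inner product, with $V_{d^2}=\mathbb{1}/\sqrt d$. Let $\ell$ be an integer with $d^2/2\le \ell\le d^2-1$, and let $c,\epsilon>0$. For $z\in\{-1,+1\}^\ell$ put $$\Delta_z=\frac{c\,\epsilon}{\sqrt{d}}\cdot\frac1{\sqrt{\ell}}\sum_{i=1}^{\ell}z_iV_i,\qquad \bar\Delta_z=\Delta_z\cdot\min\Bigl\{1,\frac1{d\|\Delta_z\|_\infty}\Bigr\},\qquad \rho_z=\frac{\mathbb{1}}d+\bar\Delta_z ,$$ and let $\boldsymbol z$ be uniform on $\{-1,+1\}^\ell$. **Theorem.**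 (a) For every $c>0$ there are constants $C,\kappa>0$, depending only on $c$, such that for all $d\ge 6$, all $\ell$ and $V_1,\dots,V_{d^2}$ as above, all $0<\epsilon<C$ and all integers $n\ge 0$, $$\mathrm{D}_{\chi^2}\bigl(\mathbb{E}_{\boldsymbol z}[\rho_{\boldsymbol z}^{\otimes n}]\,\big\|\,(\mathbb{1}/d)^{\otimes n}\bigr)\le \exp\Bigl(\frac{n^2c^4\epsilon^4}{2\ell}\Bigr)-1+\frac{4}{e^{d}},$$ and this divergence is $<\frac1{16}$ unless $n\ge\kappa\sqrt{\ell}/\epsilon^2$. (b) (Centralized mixedness testing.) There are absolute constants $C,\kappa>0$ such that the following holds for all $d\ge 6$, all $0<\epsilon<C$ and all $n\ge0$. Suppose that some two-outcome measurement on $n$ copies of an unknown $d$-dimensional state $\rho$ (an arbitrary POVM $\{T,\mathbb{1}-T\}$ on $(\mathbb{C}^d)^{\otimes n}$) accepts with probability at least $\frac34$ if $\rho=\mathbb{1}/d$, and rejects with probability at least $\frac34$ whenever $\|\rho-\mathbb{1}/d\|_1\ge\epsilon$. Then $n\ge\kappa\, d/\epsilon^2$. -/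

import Mathlib

open Matrix
open scoped ComplexOrder

noncomputable section

namespace MixednessTesting

/-- A quantum state on `ℂ^ι`: a positive semidefinite matrix of trace one. -/
def IsState {ι : Type*} [Fintype ι] (ρ : Matrix ι ι ℂ) : Prop :=
  ρ.PosSemidef ∧ ρ.trace = 1

/-- The maximally mixed state `𝟙 / d`. -/
def maxMixed (d : ℕ) : Matrix (Fin d) (Fin d) ℂ := (d : ℂ)⁻¹ • 1

/-- The `n`-fold tensor (Kronecker) power of a `d × d` matrix, its rows and columns indexed by
`n`-tuples of elements of `Fin d`. -/
def tensorPow {d : ℕ} (n : ℕ) (ρ : Matrix (Fin d) (Fin d) ℂ) :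
    Matrix (Fin n → Fin d) (Fin n → Fin d) ℂ :=
  Matrix.of fun i j => ∏ k, ρ (i k) (j k)

/-- The Schatten `∞`-norm: the operator norm with respect to the Euclidean norm. -/
def opNorm {d : ℕ} (A : Matrix (Fin d) (Fin d) ℂ) : ℝ :=
  ‖Matrix.toEuclideanCLM (n := Fin d) (𝕜 := ℂ) A‖

/-- The Schatten `1`-norm: the sum of the singular values, which are the square roots of the
eigenvalues of `Aᴴ * A`. -/
def traceNorm {d : ℕ} (A : Matrix (Fin d) (Fin d) ℂ) : ℝ :=
  ∑ i, √((Matrix.isHermitian_conjTranspose_mul_self A).eigenvalues i)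

/-- The inverse of a Hermitian matrix on its support: every nonzero eigenvalue is inverted, and the
kernel is kept. For an invertible Hermitian matrix it is the inverse matrix. -/
def supportInv {ι : Type*} [Fintype ι] [DecidableEq ι] (σ : Matrix ι ι ℂ) : Matrix ι ι ℂ :=
  cfc (fun x : ℝ => x⁻¹) σ

open scoped Classical in
/-- The quantum `χ²`-divergence `tr (σ⁻¹ (ρ - σ)²)` of two states; it is `∞` unless the support
(the range) of `ρ` is contained in that of `σ`. -/
def chiSqDiv {ι : Type*} [Fintype ι] [DecidableEq ι] (ρ σ : Matrix ι ι ℂ) : EReal :=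
  if LinearMap.range ρ.mulVecLin ≤ LinearMap.range σ.mulVecLin then
    (((supportInv σ * (ρ - σ) ^ 2).trace.re : ℝ) : EReal)
  else ⊤

/-- An orthonormal basis `V_1, …, V_{d²}` of `ℂ^{d × d}`, with respect to the Hilbert–Schmidt inner
product, made of Hermitian matrices and with last element `𝟙 / √d`.
(An orthonormal family of `d²` elements is a basis.) -/
structure IsPerturbationBasis {d : ℕ} (V : Fin (d ^ 2) → Matrix (Fin d) (Fin d) ℂ) : Prop where
  isHermitian : ∀ i, (V i).IsHermitian
  orthonormal : ∀ i j, ((V i)ᴴ * V j).trace = if i = j then 1 else 0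
  last : ∀ i : Fin (d ^ 2), (i : ℕ) + 1 = d ^ 2 → V i = ((√(d : ℝ) : ℝ) : ℂ)⁻¹ • 1

variable {d ℓ : ℕ}

/-- `Δ_z = (c ε / √d) (1 / √ℓ) ∑_{i ≤ ℓ} z_i V_i`. -/
def perturbation (c ε : ℝ) (V : Fin ℓ → Matrix (Fin d) (Fin d) ℂ) (z : Fin ℓ → ℤˣ) :
    Matrix (Fin d) (Fin d) ℂ :=
  ((c * ε / √(d : ℝ) * (1 / √(ℓ : ℝ)) : ℝ) : ℂ) • ∑ i, (((z i : ℤˣ) : ℤ) : ℂ) • V i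

/-- `Δ_z · min {1, 1 / (d ‖Δ_z‖_∞)}`. -/
def truncPerturbation (c ε : ℝ) (V : Fin ℓ → Matrix (Fin d) (Fin d) ℂ) (z : Fin ℓ → ℤˣ) :
    Matrix (Fin d) (Fin d) ℂ :=
  ((min 1 (1 / (d * opNorm (perturbation c ε V z))) : ℝ) : ℂ) • perturbation c ε V z

/-- The state `ρ_z` of the hard ensemble. -/
def hardState (c ε : ℝ) (V : Fin ℓ → Matrix (Fin d) (Fin d) ℂ) (z : Fin ℓ → ℤˣ) :
    Matrix (Fin d) (Fin d) ℂ :=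
  maxMixed d + truncPerturbation c ε V z

/-- `𝔼_z [ρ_z^{⊗ n}]` for `z` uniform on `{-1, +1}^ℓ`. -/
def hardMixture (c ε : ℝ) (V : Fin ℓ → Matrix (Fin d) (Fin d) ℂ) (n : ℕ) :
    Matrix (Fin n → Fin d) (Fin n → Fin d) ℂ :=
  ((2 : ℂ) ^ ℓ)⁻¹ • ∑ z : Fin ℓ → ℤˣ, tensorPow n (hardState c ε V z)

/-- The two-outcome measurement `{T, 1 - T}` on `n` copies (an arbitrary, possibly entangled one),
with outcome `T` read as "Accept", succeeds at `(ε, δ)`-certification of `σ`. -/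
def Certifies {n : ℕ} (T : Matrix (Fin n → Fin d) (Fin n → Fin d) ℂ)
    (σ : Matrix (Fin d) (Fin d) ℂ) (ε δ : ℝ) : Prop :=
  T.PosSemidef ∧ (1 - T).PosSemidef ∧
    1 - δ ≤ (T * tensorPow n σ).trace.re ∧
    ∀ ρ : Matrix (Fin d) (Fin d) ℂ, IsState ρ → ε ≤ traceNorm (ρ - σ) →
      1 - δ ≤ ((1 - T) * tensorPow n ρ).trace.re

end MixednessTesting

end

/-! The argument is a second-moment computation. Against the maximally mixed state the divergence of
the mixture is the average, over independent `z` and `w`, of `(d tr (ρ_z ρ_w)) ^ n`, minus one. As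
the `V i` are traceless and orthonormal, `d tr (ρ_z ρ_w) = 1 + a_z a_w x` with `x = c² ε² ⟨z, w⟩ /
ℓ` and `a_z`, `a_w` in `[0, 1]` the truncation factors. Without truncation, `1 + x ≤ exp x` and the
moment generating function of a Rademacher sum give `exp (n² c⁴ ε⁴ / (2ℓ))`.

Truncation does harm only if `x < 0`; the overlap is then still at most one, so the cost is bounded
by the probability that `z` or `w` is truncated. A net argument with Hoeffding's and Bessel's
inequalities (`card_opNorm_gt_le`) gives `‖∑ z_i V_i‖ ≤ 16 √d` outside probability `e^{-d}`. Since
`ℓ ≥ d²/2`, this means `‖Δ_z‖ ≤ 24 c ε / d`, below the threshold `1 / d` for small `ε`. The case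
analysis is `overlap_pow_le`.

For testing, take `c = 24` and `ℓ = d² - 1`. Hölder's inequality `‖Δ‖₂² ≤ ‖Δ‖_∞ ‖Δ‖₁` makes typical
`ρ_z` at least `ε`-far from `𝟙 / d`, so a valid test must reject the mixture, whereas Cauchy–Schwarz
bounds the bias of any test by the square root of the divergence. -/

namespace MixednessTesting

/-! ### Rademacher sums. -/

/-- The exponential moment of a Rademacher sum, up to normalisation. -/
theorem sum_exp_signs_le {ℓ : ℕ} (s : ℝ) (a : Fin ℓ → ℝ) :
    ∑ z : Fin ℓ → ℤˣ, Real.exp (s * ∑ i, (((z i : ℤˣ) : ℤ) : ℝ) * a i)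
      ≤ 2 ^ ℓ * Real.exp (s ^ 2 * (∑ i, a i ^ 2) / 2) := by
  have h1 : ∀ z : Fin ℓ → ℤˣ, Real.exp (s * ∑ i, (((z i : ℤˣ) : ℤ) : ℝ) * a i)
      = ∏ i, Real.exp ((((z i : ℤˣ) : ℤ) : ℝ) * (s * a i)) := by
    intro z
    rw [← Real.exp_sum, Finset.mul_sum]
    congr 1
    exact Finset.sum_congr rfl fun i _ => by ring
  have h2 : ∑ z : Fin ℓ → ℤˣ, ∏ i, Real.exp ((((z i : ℤˣ) : ℤ) : ℝ) * (s * a i))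
      = ∏ i, ∑ u : ℤˣ, Real.exp (((u : ℤ) : ℝ) * (s * a i)) := by
    rw [Finset.prod_univ_sum, Fintype.piFinset_univ]
  have h3 : ∀ x : ℝ, ∑ u : ℤˣ, Real.exp (((u : ℤ) : ℝ) * x) = 2 * Real.cosh x := by
    intro x
    have : (Finset.univ : Finset ℤˣ) = {1, -1} := by decide
    rw [this, Finset.sum_pair (by decide), Real.cosh_eq]
    simp
    ring
  simp_rw [h1]
  rw [h2]
  simp_rw [h3]
  rw [Finset.prod_mul_distrib, Finset.prod_const, Finset.card_univ, Fintype.card_fin]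
  gcongr
  calc ∏ i, Real.cosh (s * a i) ≤ ∏ i, Real.exp ((s * a i) ^ 2 / 2) :=
        Finset.prod_le_prod (fun i _ => (Real.cosh_pos _).le)
          fun i _ => Real.cosh_le_exp_half_sq _
    _ = _ := by
        rw [← Real.exp_sum, Finset.mul_sum, Finset.sum_div]
        congr 1
        exact Finset.sum_congr rfl fun i _ => by ring

/-- Hoeffding's inequality for Rademacher sums, in counting form. -/
theorem card_signs_gt_le {ℓ : ℕ} (a : Fin ℓ → ℝ) {v t : ℝ} (hv : 0 < v) (ht : 0 ≤ t)
    (ha : ∑ i, a i ^ 2 ≤ v) :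
    ((Finset.univ.filter fun z : Fin ℓ → ℤˣ => t < ∑ i, (((z i : ℤˣ) : ℤ) : ℝ) * a i).card : ℝ)
      ≤ 2 ^ ℓ * Real.exp (-(t ^ 2 / (2 * v))) := by
  set S := Finset.univ.filter fun z : Fin ℓ → ℤˣ => t < ∑ i, (((z i : ℤˣ) : ℤ) : ℝ) * a i
  -- `t / v` is the Chernoff parameter minimising `s ^ 2 * v / 2 - s * t`.
  have hs : 0 ≤ t / v := by positivity
  have h1 : (S.card : ℝ) * Real.exp (t / v * t) ≤ 2 ^ ℓ * Real.exp ((t / v) ^ 2 * v / 2) := by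
    calc (S.card : ℝ) * Real.exp (t / v * t) = ∑ _z ∈ S, Real.exp (t / v * t) := by
          rw [Finset.sum_const, nsmul_eq_mul]
      _ ≤ ∑ z ∈ S, Real.exp (t / v * ∑ i, (((z i : ℤˣ) : ℤ) : ℝ) * a i) := by
          refine Finset.sum_le_sum fun z hz => ?_
          exact Real.exp_le_exp.2 (mul_le_mul_of_nonneg_left (Finset.mem_filter.1 hz).2.le hs)
      _ ≤ ∑ z : Fin ℓ → ℤˣ, Real.exp (t / v * ∑ i, (((z i : ℤˣ) : ℤ) : ℝ) * a i) :=
          Finset.sum_le_sum_of_subset_of_nonneg (Finset.subset_univ _)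
            fun _ _ _ => (Real.exp_pos _).le
      _ ≤ 2 ^ ℓ * Real.exp ((t / v) ^ 2 * (∑ i, a i ^ 2) / 2) := sum_exp_signs_le _ _
      _ ≤ 2 ^ ℓ * Real.exp ((t / v) ^ 2 * v / 2) := by gcongr
  have h2 : Real.exp ((t / v) ^ 2 * v / 2)
      = Real.exp (-(t ^ 2 / (2 * v))) * Real.exp (t / v * t) := by
    rw [← Real.exp_add]
    congr 1
    field_simp
    ring
  rw [h2, ← mul_assoc] at h1
  exact le_of_mul_le_mul_right h1 (Real.exp_pos _)

/-! ### Operator norm of a random signed sum, by nets. -/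

/-- A `1`-net of the ball of radius `2`. -/
theorem exists_net (E : Type*) [NormedAddCommGroup E] [NormedSpace ℝ E] [FiniteDimensional ℝ E] :
    ∃ N : Finset E, N.card ≤ 5 ^ Module.finrank ℝ E ∧ (∀ u ∈ N, ‖u‖ ≤ 2) ∧
      ∀ x : E, ‖x‖ ≤ 2 → ∃ u ∈ N, ‖x - u‖ ≤ 1 := by
  classical
  -- A `1`-separated set of largest size is a net: an uncovered point could be added to it. The
  -- packing bound makes the largest size exist.
  let P : ℕ → Prop := fun m => ∃ N : Finset E, N.card = m ∧ (∀ u ∈ N, ‖u‖ ≤ 2) ∧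
    ∀ u ∈ N, ∀ v ∈ N, u ≠ v → 1 ≤ ‖u - v‖
  have hb : ∀ m, P m → m ≤ 5 ^ Module.finrank ℝ E := by
    rintro m ⟨N, rfl, h1, h2⟩
    exact Besicovitch.card_le_of_separated N h1 h2
  have h0 : P 0 := ⟨∅, by simp⟩
  obtain ⟨N, hN, h1, h2⟩ := Nat.findGreatest_spec (Nat.zero_le _) h0
    (P := P) (n := 5 ^ Module.finrank ℝ E)
  refine ⟨N, Besicovitch.card_le_of_separated N h1 h2, h1, fun x hx => ?_⟩
  by_contra! hcon
  have hxN : x ∉ N := fun h => by simpa using (hcon x h).trans_le' zero_le_one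
  have hP : P (N.card + 1) := by
    refine ⟨insert x N, Finset.card_insert_of_notMem hxN, ?_, ?_⟩
    · intro u hu
      rcases Finset.mem_insert.1 hu with rfl | hu
      exacts [hx, h1 u hu]
    · intro u hu v hv huv
      rcases Finset.mem_insert.1 hu with rfl | hu' <;> rcases Finset.mem_insert.1 hv with rfl | hv'
      · exact absurd rfl huv
      · exact (hcon v hv').le
      · rw [norm_sub_rev]; exact (hcon u hu').le
      · exact h2 u hu' v hv' huv
  have := Nat.le_findGreatest (hb _ hP) hP
  omega

/-- The operator norm is controlled by the sesquilinear form on a `1`-net of the ball of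
radius `2`. -/
theorem opNorm_le_of_net {E : Type*} [NormedAddCommGroup E] [InnerProductSpace ℂ E]
    {N : Finset E} (hN : ∀ x : E, ‖x‖ ≤ 2 → ∃ u ∈ N, ‖x - u‖ ≤ 1) (A : E →L[ℂ] E) {t : ℝ}
    (ht : 0 ≤ t) (h : ∀ u ∈ N, ∀ v ∈ N, (inner ℂ v (A u)).re ≤ t) : ‖A‖ ≤ t := by
  have h1 : ∀ u ∈ N, ‖A u‖ ≤ t := by
    intro u hu
    set y := A u with hy
    by_cases hy0 : y = 0
    · simpa [hy0] using ht
    have hn : 0 < ‖y‖ := norm_pos_iff.2 hy0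
    -- Rescaling `y` to norm `2` leaves slack for the net error: the net point `v` near `x` has `Re
    -- ⟨v, y⟩ ≥ 2‖y‖ - ‖y‖`.
    set x : E := ((2 / ‖y‖ : ℝ) : ℂ) • y with hx
    have hxn : ‖x‖ = 2 := by
      rw [hx, norm_smul, Complex.norm_real, Real.norm_eq_abs, abs_of_pos (by positivity)]
      field_simp
    obtain ⟨v, hv, hxv⟩ := hN x hxn.le
    have e1 : (inner ℂ x y).re = 2 * ‖y‖ := by
      rw [hx, inner_smul_left, Complex.conj_ofReal, Complex.re_ofReal_mul,
        inner_self_eq_norm_sq_to_K]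
      simp only [← Complex.ofReal_pow, Complex.coe_algebraMap, Complex.ofReal_re]
      field_simp
    have e2 : (inner ℂ (x - v) y).re ≤ ‖y‖ :=
      calc (inner ℂ (x - v) y).re ≤ ‖inner ℂ (x - v) y‖ := Complex.re_le_norm _
        _ ≤ ‖x - v‖ * ‖y‖ := norm_inner_le_norm _ _
        _ ≤ 1 * ‖y‖ := by gcongr
        _ = ‖y‖ := one_mul _
    rw [inner_sub_left, Complex.sub_re, e1] at e2
    linarith [h u hu v hv]
  -- The same rescaling on the input side gives `2‖A‖ ≤ t + ‖A‖`.
  have h2 : ‖A‖ ≤ (t + ‖A‖) / 2 := by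
    refine A.opNorm_le_bound (by positivity) fun x => ?_
    by_cases hx0 : x = 0
    · simp [hx0]
    have hn : 0 < ‖x‖ := norm_pos_iff.2 hx0
    set w : E := ((2 / ‖x‖ : ℝ) : ℂ) • x with hw
    have hwn : ‖w‖ = 2 := by
      rw [hw, norm_smul, Complex.norm_real, Real.norm_eq_abs, abs_of_pos (by positivity)]
      field_simp
    obtain ⟨u, hu, hwu⟩ := hN w hwn.le
    have e1 : ‖A w‖ ≤ t + ‖A‖ :=
      calc ‖A w‖ = ‖A u + A (w - u)‖ := by rw [← map_add, add_sub_cancel]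
        _ ≤ ‖A u‖ + ‖A (w - u)‖ := norm_add_le _ _
        _ ≤ t + ‖A‖ * 1 := add_le_add (h1 u hu) ((A.le_opNorm _).trans (by gcongr))
        _ = _ := by rw [mul_one]
    rw [hw, map_smul, norm_smul, Complex.norm_real, Real.norm_eq_abs,
      abs_of_pos (by positivity), div_mul_eq_mul_div, div_le_iff₀ hn] at e1
    linarith
  linarith

/-- Bessel's inequality for the coefficients `⟨v, V_i u⟩` of a Hilbert–Schmidt orthonormal
family. -/
theorem sum_re_inner_sq_le {d ℓ : ℕ} (V : Fin ℓ → Matrix (Fin d) (Fin d) ℂ)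
    (hV : ∀ i j, ((V i)ᴴ * V j).trace = if i = j then 1 else 0)
    (u v : EuclideanSpace ℂ (Fin d)) :
    ∑ i, (inner ℂ v (toEuclideanCLM (n := Fin d) (𝕜 := ℂ) (V i) u)).re ^ 2
      ≤ ‖v‖ ^ 2 * ‖u‖ ^ 2 := by
  -- After vectorisation, `⟨v, V_i u⟩` is a coefficient of the rank-one matrix `v uᴴ` along an
  -- orthonormal family.
  let w : Fin ℓ → EuclideanSpace ℂ (Fin d × Fin d) := fun i => WithLp.toLp 2 fun p => V i p.1 p.2
  let x : EuclideanSpace ℂ (Fin d × Fin d) := WithLp.toLp 2 fun p => v p.1 * star (u p.2)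
  have hw : Orthonormal ℂ w := by
    rw [orthonormal_iff_ite]
    intro i j
    rw [← hV i j]
    simp only [w, PiLp.inner_apply, RCLike.inner_apply, Matrix.trace, Matrix.diag_apply,
      Matrix.mul_apply, Matrix.conjTranspose_apply, Fintype.sum_prod_type]
    rw [Finset.sum_comm]
    exact Finset.sum_congr rfl fun _ _ => Finset.sum_congr rfl fun _ _ => mul_comm _ _
  have hx : ‖x‖ ^ 2 = ‖v‖ ^ 2 * ‖u‖ ^ 2 := by
    simp only [EuclideanSpace.norm_sq_eq, x, Fintype.sum_prod_type, norm_mul, mul_pow, norm_star,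
      Finset.sum_mul_sum]
  have hin : ∀ i, inner ℂ v (toEuclideanCLM (n := Fin d) (𝕜 := ℂ) (V i) u)
      = star (inner ℂ (w i) x) := by
    intro i
    simp only [PiLp.inner_apply, RCLike.inner_apply, w, x, Fintype.sum_prod_type,
      Matrix.ofLp_toEuclideanCLM, Matrix.mulVec, dotProduct, star_sum, star_mul', Finset.sum_mul]
    refine Finset.sum_congr rfl fun a _ => Finset.sum_congr rfl fun b _ => ?_
    simp
    ring
  rw [← hx]
  refine le_trans ?_ (hw.sum_inner_products_le x (s := Finset.univ))
  refine Finset.sum_le_sum fun i _ => ?_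
  rw [hin, ← norm_star (inner ℂ (w i) x), ← sq_abs]
  gcongr
  exact Complex.abs_re_le_norm _

/-- A random signed sum of a Hilbert–Schmidt orthonormal family has operator norm at most `16 √d`,
except with probability `e^{-d}`. -/
theorem card_opNorm_gt_le {d ℓ : ℕ} (V : Fin ℓ → Matrix (Fin d) (Fin d) ℂ)
    (hV : ∀ i j, ((V i)ᴴ * V j).trace = if i = j then 1 else 0) :
    ((Finset.univ.filter fun z : Fin ℓ → ℤˣ =>
        16 * √(d : ℝ) < opNorm (∑ i, (((z i : ℤˣ) : ℤ) : ℂ) • V i)).card : ℝ)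
      ≤ 2 ^ ℓ * Real.exp (-d) := by
  classical
  obtain ⟨N, hcard, hN2, hN⟩ := exists_net (EuclideanSpace ℂ (Fin d))
  have hfin : Module.finrank ℝ (EuclideanSpace ℂ (Fin d)) = 2 * d := by
    rw [finrank_real_of_complex, finrank_euclideanSpace_fin]
  rw [hfin] at hcard
  let a : EuclideanSpace ℂ (Fin d) × EuclideanSpace ℂ (Fin d) → Fin ℓ → ℝ := fun p i =>
    (inner ℂ p.2 (toEuclideanCLM (n := Fin d) (𝕜 := ℂ) (V i) p.1)).re
  let B : EuclideanSpace ℂ (Fin d) × EuclideanSpace ℂ (Fin d) → Finset (Fin ℓ → ℤˣ) := fun p =>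
    Finset.univ.filter fun z => 16 * √(d : ℝ) < ∑ i, (((z i : ℤˣ) : ℤ) : ℝ) * a p i
  -- With `t = 16 √d` and variance bound `2² · 2² = 16`, the Hoeffding exponent is `256 d / 32 = 8
  -- d`. The union bound over at most `25^d · 25^d = 625^d ≤ e^{7d}` pairs leaves `e^{-d}`.
  have hB : ∀ p ∈ N ×ˢ N, ((B p).card : ℝ) ≤ 2 ^ ℓ * Real.exp (-(8 * d)) := by
    intro p hp
    obtain ⟨h1, h2⟩ := Finset.mem_product.1 hp
    have hsum : ∑ i, a p i ^ 2 ≤ 16 := by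
      refine (sum_re_inner_sq_le V hV p.1 p.2).trans ?_
      calc ‖p.2‖ ^ 2 * ‖p.1‖ ^ 2 ≤ 2 ^ 2 * 2 ^ 2 := by
            gcongr
            exacts [hN2 _ h2, hN2 _ h1]
        _ = 16 := by norm_num
    refine (card_signs_gt_le (a p) (by norm_num : (0 : ℝ) < 16)
      (by positivity : 0 ≤ 16 * √(d : ℝ)) hsum).trans_eq ?_
    rw [mul_pow, Real.sq_sqrt (Nat.cast_nonneg d)]
    congr 3
    ring
  have hsub : (Finset.univ.filter fun z : Fin ℓ → ℤˣ =>
      16 * √(d : ℝ) < opNorm (∑ i, (((z i : ℤˣ) : ℤ) : ℂ) • V i)) ⊆ (N ×ˢ N).biUnion B := by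
    intro z hz
    by_contra hcon
    have hz' := (Finset.mem_filter.1 hz).2
    refine absurd hz' (not_lt.2 (opNorm_le_of_net hN _ (by positivity) fun u hu v hv => ?_))
    by_contra! hlt
    refine hcon (Finset.mem_biUnion.2 ⟨(u, v), Finset.mk_mem_product hu hv, ?_⟩)
    refine Finset.mem_filter.2 ⟨Finset.mem_univ _, hlt.trans_eq ?_⟩
    rw [map_sum, _root_.sum_apply, inner_sum, Complex.re_sum]
    refine Finset.sum_congr rfl fun i _ => ?_
    rw [map_smul, _root_.smul_apply, inner_smul_right,
      show (((z i : ℤˣ) : ℤ) : ℂ) = ((((z i : ℤˣ) : ℤ) : ℝ) : ℂ) by push_cast; rfl,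
      Complex.re_ofReal_mul]
  have hNN : ((N ×ˢ N).card : ℝ) ≤ 625 ^ d := by
    rw [Finset.card_product]
    have : N.card * N.card ≤ 625 ^ d :=
      (Nat.mul_le_mul hcard hcard).trans_eq (by rw [← mul_pow, pow_mul]; norm_num)
    exact_mod_cast this
  have h625 : (625 : ℝ) ≤ Real.exp 7 := by
    have h := Real.exp_one_gt_d9
    calc (625 : ℝ) ≤ 2.7 ^ 7 := by norm_num
      _ ≤ Real.exp 1 ^ 7 := by gcongr; linarith
      _ = Real.exp 7 := by rw [← Real.exp_nat_mul]; norm_num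
  calc _ ≤ (((N ×ˢ N).biUnion B).card : ℝ) := by exact_mod_cast Finset.card_le_card hsub
    _ ≤ ∑ p ∈ N ×ˢ N, ((B p).card : ℝ) := by exact_mod_cast Finset.card_biUnion_le
    _ ≤ (N ×ˢ N).card * (2 ^ ℓ * Real.exp (-(8 * d))) := by
        simpa using Finset.sum_le_sum hB
    _ ≤ Real.exp 7 ^ d * (2 ^ ℓ * Real.exp (-(8 * d))) := by
        gcongr
        exact hNN.trans (by gcongr)
    _ = 2 ^ ℓ * Real.exp (-d) := by
        rw [← Real.exp_nat_mul, mul_left_comm, ← Real.exp_add]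
        congr 2
        ring

/-! ### Tensor powers, positivity and the divergence from the maximally mixed state. -/

open scoped MatrixOrder Matrix.Norms.L2Operator in
theorem PosSemidef.exists_eq_conjTranspose_mul_self {ι : Type*} [Fintype ι] {A : Matrix ι ι ℂ}
    (hA : A.PosSemidef) : ∃ B : Matrix ι ι ℂ, A = Bᴴ * B := by
  classical
  exact CStarAlgebra.nonneg_iff_eq_star_mul_self.1 hA.nonneg

section TensorPow

variable {d : ℕ} (n : ℕ)

theorem tensorPow_mul (A B : Matrix (Fin d) (Fin d) ℂ) :
    tensorPow n (A * B) = tensorPow n A * tensorPow n B := by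
  ext i j
  simp only [tensorPow, Matrix.of_apply, Matrix.mul_apply, Finset.prod_univ_sum,
    Fintype.piFinset_univ, Finset.prod_mul_distrib]

theorem trace_tensorPow (A : Matrix (Fin d) (Fin d) ℂ) :
    (tensorPow n A).trace = A.trace ^ n := by
  have h := Finset.prod_univ_sum (fun _ : Fin n => (Finset.univ : Finset (Fin d)))
    fun _ j => A j j
  rw [Fintype.piFinset_univ, Finset.prod_const, Finset.card_univ, Fintype.card_fin] at h
  simpa only [Matrix.trace, Matrix.diag_apply, tensorPow, Matrix.of_apply] using h.symm

theorem tensorPow_conjTranspose (A : Matrix (Fin d) (Fin d) ℂ) :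
    tensorPow n Aᴴ = (tensorPow n A)ᴴ := by
  ext i j
  simp [tensorPow, Matrix.conjTranspose_apply]

theorem PosSemidef.tensorPow {A : Matrix (Fin d) (Fin d) ℂ} (hA : A.PosSemidef) :
    (tensorPow n A).PosSemidef := by
  obtain ⟨B, rfl⟩ := PosSemidef.exists_eq_conjTranspose_mul_self hA
  rw [tensorPow_mul, tensorPow_conjTranspose]
  exact Matrix.posSemidef_conjTranspose_mul_self _

theorem IsState.tensorPow {ρ : Matrix (Fin d) (Fin d) ℂ} (h : IsState ρ) :
    IsState (tensorPow n ρ) :=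
  ⟨PosSemidef.tensorPow n h.1, by rw [trace_tensorPow, h.2, one_pow]⟩

theorem tensorPow_maxMixed :
    tensorPow n (maxMixed d) = ((((d : ℝ) ^ n)⁻¹ : ℝ) : ℂ) • 1 := by
  ext i j
  change ∏ k, (d : ℂ)⁻¹ * (1 : Matrix (Fin d) (Fin d) ℂ) (i k) (j k) = _ * _
  rw [Finset.prod_mul_distrib, Finset.prod_const, Finset.card_univ, Fintype.card_fin]
  push_cast
  rw [inv_pow]
  refine congrArg _ ?_
  by_cases h : i = j
  · subst h
    rw [Matrix.one_apply_eq]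
    exact Finset.prod_eq_one fun k _ => Matrix.one_apply_eq _
  · obtain ⟨k, hk⟩ := Function.ne_iff.1 h
    rw [Matrix.one_apply_ne h]
    exact Finset.prod_eq_zero (Finset.mem_univ k) (Matrix.one_apply_ne hk)

end TensorPow

theorem isState_maxMixed {d : ℕ} (hd : d ≠ 0) : IsState (maxMixed d) := by
  constructor
  · exact Matrix.PosSemidef.one.smul (inv_nonneg.2 (Nat.cast_nonneg d))
  · simp [maxMixed, hd]

/-- Writing `A = Cᴴ C`, the trace is that of the positive semidefinite `C B Cᴴ`. -/
theorem trace_mul_re_nonneg {ι : Type*} [Fintype ι] {A B : Matrix ι ι ℂ} (hA : A.PosSemidef)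
    (hB : B.PosSemidef) : 0 ≤ (A * B).trace.re := by
  classical
  obtain ⟨C, rfl⟩ := PosSemidef.exists_eq_conjTranspose_mul_self hA
  rw [Matrix.mul_assoc, Matrix.trace_mul_comm]
  exact (Complex.le_def.1 (hB.mul_mul_conjTranspose_same C).trace_nonneg).1

/-- The `χ²`-divergence from a nonzero multiple of the identity. -/
theorem chiSqDiv_smul_one {ι : Type*} [Fintype ι] [DecidableEq ι] (M : Matrix ι ι ℂ) {r : ℝ}
    (hr : r ≠ 0) :
    chiSqDiv M ((r : ℂ) • 1) = ((r⁻¹ * ((M - (r : ℂ) • 1) ^ 2).trace.re : ℝ) : EReal) := by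
  have hrange : LinearMap.range ((r : ℂ) • (1 : Matrix ι ι ℂ)).mulVecLin = ⊤ := by
    rw [LinearMap.range_eq_top]
    intro x
    refine ⟨(r : ℂ)⁻¹ • x, ?_⟩
    rw [Matrix.mulVecLin_apply, Matrix.smul_mulVec, Matrix.one_mulVec,
      smul_inv_smul₀ (Complex.ofReal_ne_zero.2 hr)]
  have hinv : supportInv ((r : ℂ) • (1 : Matrix ι ι ℂ)) = ((r⁻¹ : ℝ) : ℂ) • 1 := by
    have h : ∀ s : ℝ, algebraMap ℝ (Matrix ι ι ℂ) s = (s : ℂ) • 1 := by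
      intro s
      rw [Algebra.algebraMap_eq_smul_one, ← Complex.coe_smul]
    rw [supportInv, ← h, ← h]
    exact cfc_algebraMap r _
  rw [chiSqDiv, if_pos (hrange ▸ le_top), hinv, Matrix.smul_mul, one_mul, Matrix.trace_smul,
    smul_eq_mul, Complex.re_ofReal_mul]

/-- As `M` has trace one, the cross terms of `(M - 𝟙 / d^n)²` collapse to a constant and only the
purity of `M` remains. -/
theorem chiSqDiv_tensorPow_maxMixed {d n : ℕ} (hd : d ≠ 0)
    (M : Matrix (Fin n → Fin d) (Fin n → Fin d) ℂ) (hM : M.trace = 1) :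
    chiSqDiv M (tensorPow n (maxMixed d))
      = (((d : ℝ) ^ n * (M * M).trace.re - 1 : ℝ) : EReal) := by
  have hd' : (d : ℝ) ^ n ≠ 0 := pow_ne_zero _ (Nat.cast_ne_zero.2 hd)
  have hdc : (d : ℂ) ^ n ≠ 0 := pow_ne_zero _ (Nat.cast_ne_zero.2 hd)
  rw [tensorPow_maxMixed, chiSqDiv_smul_one M (inv_ne_zero hd'), inv_inv]
  have h : ((M - ((((d : ℝ) ^ n)⁻¹ : ℝ) : ℂ) • 1) ^ 2).trace
      = (M * M).trace - ((((d : ℝ) ^ n)⁻¹ : ℝ) : ℂ) := by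
    rw [sq]
    simp only [Matrix.sub_mul, Matrix.mul_sub, Matrix.smul_mul, Matrix.mul_smul, one_mul, mul_one,
      Matrix.trace_sub, Matrix.trace_smul, hM, Matrix.trace_one, Fintype.card_fun, Fintype.card_fin,
      smul_eq_mul]
    push_cast
    field_simp
    ring
  rw [h, Complex.sub_re, Complex.ofReal_re, mul_sub, mul_inv_cancel₀ hd']

/-! ### Traceless families, perturbations and truncation. -/

/-- A Hermitian, traceless, Hilbert–Schmidt orthonormal family. -/
structure IsTracelessFamily {d ℓ : ℕ} (V : Fin ℓ → Matrix (Fin d) (Fin d) ℂ) : Prop where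
  isHermitian : ∀ i, (V i).IsHermitian
  orthonormal : ∀ i j, ((V i)ᴴ * V j).trace = if i = j then 1 else 0
  trace_eq_zero : ∀ i, (V i).trace = 0

/-- Tracelessness is orthogonality to the last basis element, a multiple of the identity, which `ℓ <
d ^ 2` keeps out of the family. -/
theorem IsPerturbationBasis.isTracelessFamily {d ℓ : ℕ} {V : Fin (d ^ 2) → Matrix (Fin d) (Fin d) ℂ}
    (hV : IsPerturbationBasis V) (hd : d ≠ 0) (hℓ : ℓ < d ^ 2) :
    IsTracelessFamily fun i : Fin ℓ => V (Fin.castLE hℓ.le i) where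
  isHermitian _ := hV.isHermitian _
  orthonormal i j := by
    rw [hV.orthonormal]
    simp
  trace_eq_zero i := by
    have hpos : 0 < d ^ 2 := by positivity
    have hlast := hV.last ⟨d ^ 2 - 1, by omega⟩ (by simp only; omega)
    have h := hV.orthonormal (Fin.castLE hℓ.le i) ⟨d ^ 2 - 1, by omega⟩
    have hne : Fin.castLE hℓ.le i ≠ ⟨d ^ 2 - 1, by omega⟩ := by
      intro h
      have := congrArg Fin.val h
      have := i.2
      simp only [Fin.val_castLE] at *
      omega
    rw [hlast, if_neg hne, (hV.isHermitian _).eq, Matrix.mul_smul, mul_one, Matrix.trace_smul,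
      smul_eq_mul, mul_eq_zero] at h
    refine h.resolve_left (inv_ne_zero (Complex.ofReal_ne_zero.2 ?_))
    exact (Real.sqrt_pos.2 (by positivity)).ne'

theorem opNorm_nonneg {d : ℕ} (A : Matrix (Fin d) (Fin d) ℂ) : 0 ≤ opNorm A := norm_nonneg _

theorem opNorm_smul {d : ℕ} (r : ℝ) (A : Matrix (Fin d) (Fin d) ℂ) :
    opNorm ((r : ℂ) • A) = |r| * opNorm A := by
  rw [opNorm, map_smul, norm_smul, Complex.norm_real, Real.norm_eq_abs, opNorm]

/-- An eigenvalue `λ` of the sum makes `λ - r` an eigenvalue of `A`, so `|λ - r| ≤ r`. -/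
theorem posSemidef_smul_one_add {d : ℕ} {A : Matrix (Fin d) (Fin d) ℂ} (hA : A.IsHermitian)
    {r : ℝ} (hr : opNorm A ≤ r) : ((r : ℂ) • 1 + A).PosSemidef := by
  have hH : ((r : ℂ) • 1 + A).IsHermitian := by
    refine Matrix.IsHermitian.add ?_ hA
    rw [Matrix.IsHermitian, Matrix.conjTranspose_smul, Matrix.conjTranspose_one]
    simp
  rw [hH.posSemidef_iff_eigenvalues_nonneg]
  intro j
  have h1 := hH.mulVec_eigenvectorBasis j
  have h2 : toEuclideanCLM (n := Fin d) (𝕜 := ℂ) A (hH.eigenvectorBasis j)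
      = ((hH.eigenvalues j - r : ℝ) : ℂ) • hH.eigenvectorBasis j := by
    apply WithLp.ofLp_injective
    rw [Matrix.ofLp_toEuclideanCLM, WithLp.ofLp_smul]
    rw [Matrix.add_mulVec, Matrix.smul_mulVec, Matrix.one_mulVec, ← Complex.coe_smul,
      ← eq_sub_iff_add_eq'] at h1
    rw [h1, Complex.ofReal_sub, sub_smul]
  have h3 := (toEuclideanCLM (n := Fin d) (𝕜 := ℂ) A).le_opNorm (hH.eigenvectorBasis j)
  rw [h2, norm_smul, hH.eigenvectorBasis.norm_eq_one, mul_one, mul_one, Complex.norm_real,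
    Real.norm_eq_abs] at h3
  have h4 := (abs_le.1 (h3.trans hr)).1
  change 0 ≤ hH.eigenvalues j
  linarith

section Perturbation

variable {d ℓ : ℕ} (c ε : ℝ) {V : Fin ℓ → Matrix (Fin d) (Fin d) ℂ}

theorem IsTracelessFamily.isHermitian_perturbation (hV : IsTracelessFamily V) (z : Fin ℓ → ℤˣ) :
    (perturbation c ε V z).IsHermitian := by
  rw [Matrix.IsHermitian, perturbation, Matrix.conjTranspose_smul, Matrix.conjTranspose_sum]
  congr 1
  · simp
  · refine Finset.sum_congr rfl fun i _ => ?_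
    rw [Matrix.conjTranspose_smul, (hV.isHermitian i).eq]
    simp

theorem IsTracelessFamily.trace_perturbation (hV : IsTracelessFamily V) (z : Fin ℓ → ℤˣ) :
    (perturbation c ε V z).trace = 0 := by
  simp [perturbation, Matrix.trace_sum, hV.trace_eq_zero]

theorem IsTracelessFamily.trace_perturbation_mul (hV : IsTracelessFamily V)
    (z w : Fin ℓ → ℤˣ) :
    (perturbation c ε V z * perturbation c ε V w).trace
      = ((c ^ 2 * ε ^ 2 / (d * ℓ) * ∑ i, (((z i : ℤˣ) : ℤ) : ℝ) * (((w i : ℤˣ) : ℤ) : ℝ) : ℝ) : ℂ)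
      := by
  have h : ((∑ i, (((z i : ℤˣ) : ℤ) : ℂ) • V i) * ∑ j, (((w j : ℤˣ) : ℤ) : ℂ) • V j).trace
      = ∑ i, (((z i : ℤˣ) : ℤ) : ℂ) * (((w i : ℤˣ) : ℤ) : ℂ) := by
    rw [Finset.sum_mul_sum, Matrix.trace_sum]
    refine Finset.sum_congr rfl fun i _ => ?_
    rw [Matrix.trace_sum, Finset.sum_eq_single i]
    · have := hV.orthonormal i i
      rw [(hV.isHermitian i).eq, if_pos rfl] at this
      rw [Matrix.smul_mul, Matrix.mul_smul, Matrix.trace_smul, Matrix.trace_smul, this]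
      simp
    · intro j _ hij
      have := hV.orthonormal i j
      rw [(hV.isHermitian i).eq, if_neg hij.symm] at this
      rw [Matrix.smul_mul, Matrix.mul_smul, Matrix.trace_smul, Matrix.trace_smul, this]
      simp
    · simp
  have hs : (c * ε / √(d : ℝ) * (1 / √(ℓ : ℝ))) * (c * ε / √(d : ℝ) * (1 / √(ℓ : ℝ)))
      = c ^ 2 * ε ^ 2 / (d * ℓ) := by
    have h1 := Real.mul_self_sqrt (Nat.cast_nonneg (α := ℝ) d)
    have h2 := Real.mul_self_sqrt (Nat.cast_nonneg (α := ℝ) ℓ)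
    calc _ = c ^ 2 * ε ^ 2 / ((√(d : ℝ) * √(d : ℝ)) * (√(ℓ : ℝ) * √(ℓ : ℝ))) := by
          rw [div_mul_div_comm, div_mul_div_comm]
          congr 1 <;> ring
      _ = _ := by rw [h1, h2]
  rw [perturbation, perturbation, Matrix.smul_mul, Matrix.mul_smul, Matrix.trace_smul,
    Matrix.trace_smul, h, smul_eq_mul, smul_eq_mul, ← mul_assoc, ← Complex.ofReal_mul, hs,
    Complex.ofReal_mul]
  push_cast
  rfl

variable (V) in
/-- The factor by which `truncPerturbation` shrinks `perturbation`. -/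
noncomputable def truncFactor (z : Fin ℓ → ℤˣ) : ℝ := min 1 (1 / (d * opNorm (perturbation c ε V z)))

theorem truncPerturbation_eq (z : Fin ℓ → ℤˣ) :
    truncPerturbation c ε V z = (truncFactor c ε V z : ℂ) • perturbation c ε V z := rfl

theorem truncFactor_nonneg (z : Fin ℓ → ℤˣ) : 0 ≤ truncFactor c ε V z :=
  le_min zero_le_one (by have := opNorm_nonneg (perturbation c ε V z); positivity)

theorem truncFactor_le_one (z : Fin ℓ → ℤˣ) : truncFactor c ε V z ≤ 1 := min_le_left _ _

theorem opNorm_truncPerturbation_le (z : Fin ℓ → ℤˣ) :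
    opNorm (truncPerturbation c ε V z) ≤ (d : ℝ)⁻¹ := by
  rw [truncPerturbation_eq, opNorm_smul, abs_of_nonneg (truncFactor_nonneg c ε z)]
  have h0 := opNorm_nonneg (perturbation c ε V z)
  rcases h0.eq_or_lt with h | h
  · rw [← h, mul_zero]
    positivity
  · calc _ ≤ 1 / (d * opNorm (perturbation c ε V z)) * opNorm (perturbation c ε V z) := by
          gcongr
          exact min_le_right _ _
      _ = (d : ℝ)⁻¹ := by rw [one_div, mul_inv, inv_mul_cancel_right₀ h.ne']

/-- The Hilbert–Schmidt norm squared is `c² ε² / d`, hence nonzero. This matters because `1 / 0 = 0`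
would turn the truncation factor of a zero perturbation into `0` instead of `1`. -/
theorem IsTracelessFamily.opNorm_perturbation_pos (hV : IsTracelessFamily V) (hd : d ≠ 0)
    (hℓ : ℓ ≠ 0) {c ε : ℝ} (hc : 0 < c) (hε : 0 < ε) (z : Fin ℓ → ℤˣ) :
    0 < opNorm (perturbation c ε V z) := by
  refine (opNorm_nonneg _).lt_of_ne fun h0 => ?_
  have h0' : perturbation c ε V z = 0 :=
    (toEuclideanCLM (n := Fin d) (𝕜 := ℂ)).injective
      ((norm_eq_zero.1 h0.symm).trans (map_zero _).symm)
  have h := hV.trace_perturbation_mul c ε z z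
  rw [h0', Matrix.mul_zero, Matrix.trace_zero, eq_comm, Complex.ofReal_eq_zero] at h
  have hz : ∑ i, (((z i : ℤˣ) : ℤ) : ℝ) * (((z i : ℤˣ) : ℤ) : ℝ) = ℓ := by
    simp [← Int.cast_mul, ← Units.val_mul]
  rw [hz] at h
  have : 0 < c ^ 2 * ε ^ 2 / (d * ℓ) * (ℓ : ℝ) := by positivity
  exact this.ne' h

theorem truncFactor_eq_one {c ε : ℝ} (hd : d ≠ 0) {z : Fin ℓ → ℤˣ}
    (h0 : 0 < opNorm (perturbation c ε V z)) (h : opNorm (perturbation c ε V z) ≤ (d : ℝ)⁻¹) :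
    truncFactor c ε V z = 1 := by
  have hd' : (0 : ℝ) < d := by positivity
  refine min_eq_left ?_
  rw [le_div_iff₀ (by positivity), one_mul]
  calc _ ≤ (d : ℝ) * (d : ℝ)⁻¹ := by gcongr
    _ = 1 := mul_inv_cancel₀ hd'.ne'

theorem IsTracelessFamily.isState_hardState (hV : IsTracelessFamily V) (hd : d ≠ 0)
    (z : Fin ℓ → ℤˣ) : IsState (hardState c ε V z) := by
  constructor
  · have hH : (truncPerturbation c ε V z).IsHermitian := by
      rw [truncPerturbation_eq, Matrix.IsHermitian, Matrix.conjTranspose_smul,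
        (hV.isHermitian_perturbation c ε z).eq]
      simp
    have := posSemidef_smul_one_add hH (opNorm_truncPerturbation_le c ε z)
    rw [Complex.ofReal_inv, Complex.ofReal_natCast] at this
    exact this
  · rw [hardState, Matrix.trace_add, (isState_maxMixed hd).2, truncPerturbation_eq,
      Matrix.trace_smul, hV.trace_perturbation, smul_zero, add_zero]

/-- Tracelessness kills the terms linear in a perturbation; orthonormality reduces the quadratic one
to `⟨z, w⟩`. -/
theorem IsTracelessFamily.trace_hardState_mul (hV : IsTracelessFamily V) (hd : d ≠ 0)
    (z w : Fin ℓ → ℤˣ) :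
    (d : ℂ) * (hardState c ε V z * hardState c ε V w).trace
      = ((1 + truncFactor c ε V z * truncFactor c ε V w *
          (c ^ 2 * ε ^ 2 / ℓ * ∑ i, (((z i : ℤˣ) : ℤ) : ℝ) * (((w i : ℤˣ) : ℤ) : ℝ)) : ℝ) : ℂ) := by
  have hdc : (d : ℂ) ≠ 0 := Nat.cast_ne_zero.2 hd
  have hM : (maxMixed d * maxMixed d).trace = (d : ℂ)⁻¹ := by
    simp [maxMixed, hdc]
  have h0 := hV.trace_perturbation c ε
  rw [hardState, hardState, add_mul, mul_add, mul_add, Matrix.trace_add, Matrix.trace_add,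
    Matrix.trace_add, hM, truncPerturbation_eq, truncPerturbation_eq, Matrix.smul_mul,
    Matrix.mul_smul, Matrix.mul_smul, Matrix.smul_mul, maxMixed, Matrix.smul_mul, Matrix.mul_smul,
    one_mul, mul_one]
  simp only [Matrix.trace_smul, h0, hV.trace_perturbation_mul, smul_eq_mul, mul_zero, add_zero,
    zero_add]
  push_cast
  field_simp

/-- The operator norm of a typical perturbation. -/
theorem opNorm_perturbation_le {c ε : ℝ} (hc : 0 ≤ c) (hε : 0 ≤ ε) (hd : d ≠ 0)
    (hℓ : (d : ℝ) ^ 2 / 2 ≤ ℓ) {z : Fin ℓ → ℤˣ}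
    (hz : opNorm (∑ i, (((z i : ℤˣ) : ℤ) : ℂ) • V i) ≤ 16 * √(d : ℝ)) :
    opNorm (perturbation c ε V z) ≤ 24 * c * ε / d := by
  have hd' : (0 : ℝ) < d := by positivity
  have hsd : 0 < √(d : ℝ) := Real.sqrt_pos.2 hd'
  -- `4/9 ≤ 1/2`; the rational constant turns `16` into `16 / (2/3) = 24`.
  have hsl : 2 / 3 * (d : ℝ) ≤ √(ℓ : ℝ) := Real.le_sqrt_of_sq_le (by nlinarith)
  have hsl0 : 0 < √(ℓ : ℝ) := lt_of_lt_of_le (by positivity) hsl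
  rw [perturbation, opNorm_smul, abs_of_nonneg (by positivity)]
  calc _ ≤ c * ε / √(d : ℝ) * (1 / √(ℓ : ℝ)) * (16 * √(d : ℝ)) := by gcongr
    _ = 16 * c * ε / √(ℓ : ℝ) := by field_simp
    _ ≤ 16 * c * ε / (2 / 3 * (d : ℝ)) := by gcongr
    _ = _ := by field_simp; ring

theorem IsTracelessFamily.truncFactor_eq_one (hV : IsTracelessFamily V) {c ε : ℝ} (hc : 0 < c)
    (hε : 0 < ε) (hcε : 24 * c * ε ≤ 1) (hd : d ≠ 0) (hℓ : (d : ℝ) ^ 2 / 2 ≤ ℓ) {z : Fin ℓ → ℤˣ}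
    (hz : opNorm (∑ i, (((z i : ℤˣ) : ℤ) : ℂ) • V i) ≤ 16 * √(d : ℝ)) :
    truncFactor c ε V z = 1 := by
  have hℓ0 : ℓ ≠ 0 := by
    rintro rfl
    have : (0 : ℝ) < (d : ℝ) ^ 2 / 2 := by positivity
    simp only [Nat.cast_zero] at hℓ
    linarith
  refine MixednessTesting.truncFactor_eq_one hd (hV.opNorm_perturbation_pos hd hℓ0 hc hε z)
    ((opNorm_perturbation_le hc.le hε.le hd hℓ hz).trans ?_)
  rw [← one_div]
  gcongr

end Perturbation

/-! ### The divergence of the mixture. -/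

section Mixture

variable {d ℓ : ℕ} {c ε : ℝ} {V : Fin ℓ → Matrix (Fin d) (Fin d) ℂ}

theorem IsTracelessFamily.trace_hardMixture (hV : IsTracelessFamily V) (hd : d ≠ 0) (n : ℕ) :
    (hardMixture c ε V n).trace = 1 := by
  simp only [hardMixture, Matrix.trace_smul, Matrix.trace_sum, trace_tensorPow,
    (hV.isState_hardState c ε hd _).2, one_pow]
  simp

/-- Squaring the mixture yields two independent copies `z`, `w`, and the trace of a tensor power is
a power of the trace. -/
theorem IsTracelessFamily.chiSqDiv_hardMixture (hV : IsTracelessFamily V) (hd : d ≠ 0) (n : ℕ) :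
    chiSqDiv (hardMixture c ε V n) (tensorPow n (maxMixed d))
      = ((((2 : ℝ) ^ ℓ)⁻¹ * (((2 : ℝ) ^ ℓ)⁻¹ * ∑ z : Fin ℓ → ℤˣ, ∑ w : Fin ℓ → ℤˣ,
          (d * (hardState c ε V z * hardState c ε V w).trace.re) ^ n) - 1 : ℝ) : EReal) := by
  rw [chiSqDiv_tensorPow_maxMixed hd _ (hV.trace_hardMixture hd n)]
  congr 2
  have hre : ∀ z w, ((hardState c ε V z * hardState c ε V w).trace.re : ℂ)
      = (hardState c ε V z * hardState c ε V w).trace := by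
    intro z w
    have h := hV.trace_hardState_mul c ε hd z w
    have hdc : (d : ℂ) ≠ 0 := Nat.cast_ne_zero.2 hd
    rw [← eq_inv_mul_iff_mul_eq₀ hdc, ← Complex.ofReal_natCast, ← Complex.ofReal_inv,
      ← Complex.ofReal_mul] at h
    rw [h, Complex.ofReal_re]
  have h : (d : ℂ) ^ n * (hardMixture c ε V n * hardMixture c ε V n).trace
      = (((((2 : ℝ) ^ ℓ)⁻¹ * (((2 : ℝ) ^ ℓ)⁻¹ * ∑ z : Fin ℓ → ℤˣ, ∑ w : Fin ℓ → ℤˣ,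
          (d * (hardState c ε V z * hardState c ε V w).trace.re) ^ n)) : ℝ) : ℂ) := by
    simp only [hardMixture, Matrix.smul_mul, Matrix.mul_smul, Matrix.trace_smul,
      Finset.sum_mul_sum, Matrix.trace_sum, ← tensorPow_mul, trace_tensorPow, smul_eq_mul]
    push_cast
    simp only [hre, mul_pow, ← Finset.mul_sum]
    ring
  have h' := congrArg Complex.re h
  rwa [Complex.ofReal_re, ← Complex.ofReal_natCast, ← Complex.ofReal_pow,
    Complex.re_ofReal_mul] at h'

/-- The overlap of two states of the ensemble, compared with that of the untruncated ones. -/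
theorem IsTracelessFamily.overlap_pow_le (hV : IsTracelessFamily V) (hc : 0 < c) (hε : 0 < ε)
    (hcε : 24 * c * ε ≤ 1) (hd : d ≠ 0) (hℓ : (d : ℝ) ^ 2 / 2 ≤ ℓ) (n : ℕ) (z w : Fin ℓ → ℤˣ) :
    (d * (hardState c ε V z * hardState c ε V w).trace.re) ^ n
      ≤ Real.exp (n * (c ^ 2 * ε ^ 2 / ℓ) * ∑ i, (((w i : ℤˣ) : ℤ) : ℝ) * (((z i : ℤˣ) : ℤ) : ℝ))
        + (if 16 * √(d : ℝ) < opNorm (∑ i, (((z i : ℤˣ) : ℤ) : ℂ) • V i) then 1 else 0)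
        + (if 16 * √(d : ℝ) < opNorm (∑ i, (((w i : ℤˣ) : ℤ) : ℂ) • V i) then 1 else 0) := by
  set x : ℝ := c ^ 2 * ε ^ 2 / ℓ * ∑ i, (((z i : ℤˣ) : ℤ) : ℝ) * (((w i : ℤˣ) : ℤ) : ℝ) with hx
  set y : ℝ := d * (hardState c ε V z * hardState c ε V w).trace.re with hy
  set a := truncFactor c ε V z with ha
  set b := truncFactor c ε V w with hb
  have hyx : y = 1 + a * b * x := by
    have h := congrArg Complex.re (hV.trace_hardState_mul c ε hd z w)
    rwa [Complex.ofReal_re, ← Complex.ofReal_natCast, Complex.re_ofReal_mul] at h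
  -- Nonnegativity of the overlap is what lets bounds on `y` pass to `n`-th powers.
  have hy0 : 0 ≤ y := mul_nonneg (Nat.cast_nonneg d)
    (trace_mul_re_nonneg (hV.isState_hardState c ε hd z).1 (hV.isState_hardState c ε hd w).1)
  have hexp : Real.exp (n * (c ^ 2 * ε ^ 2 / ℓ) *
      ∑ i, (((w i : ℤˣ) : ℤ) : ℝ) * (((z i : ℤˣ) : ℤ) : ℝ)) = Real.exp x ^ n := by
    rw [← Real.exp_nat_mul, hx, mul_assoc]
    simp only [mul_comm]
  rw [hexp]
  have hab0 : 0 ≤ a * b := mul_nonneg (truncFactor_nonneg c ε z) (truncFactor_nonneg c ε w)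
  have hab1 : a * b ≤ 1 :=
    mul_le_one₀ (truncFactor_le_one c ε z) (truncFactor_nonneg c ε w) (truncFactor_le_one c ε w)
  have key : y ≤ Real.exp x → y ^ n ≤ Real.exp x ^ n := fun h => pow_le_pow_left₀ hy0 h n
  have hE : 0 ≤ Real.exp x ^ n := pow_nonneg (Real.exp_pos x).le n
  have h1 : x < 0 → y ^ n ≤ 1 := fun h =>
    pow_le_one₀ hy0 (by rw [hyx]; linarith [mul_nonpos_of_nonneg_of_nonpos hab0 h.le])
  -- For `x ≥ 0`, shrinking only helps: `1 + a b x ≤ 1 + x ≤ exp x`. For `x < 0` an indicator pays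
  -- for `y ^ n ≤ 1`, unless both `z` and `w` are typical and nothing is truncated.
  by_cases hx0 : 0 ≤ x
  · have : y ^ n ≤ Real.exp x ^ n := by
      refine key ?_
      rw [hyx]
      linarith [Real.add_one_le_exp x, mul_le_of_le_one_left hx0 hab1]
    split_ifs <;> linarith
  · have h1 := h1 (not_le.1 hx0)
    split_ifs with hz hw hw
    · linarith
    · linarith
    · linarith
    · have e1 : a = 1 := hV.truncFactor_eq_one hc hε hcε hd hℓ (not_lt.1 hz)
      have e2 : b = 1 := hV.truncFactor_eq_one hc hε hcε hd hℓ (not_lt.1 hw)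
      rw [e1, e2, one_mul, one_mul] at hyx
      have := key (by rw [hyx]; linarith [Real.add_one_le_exp x])
      linarith

/-- Averaging `overlap_pow_le`, the exponential is handled for each fixed `z` by the moment bound in
`w`, and each indicator costs `e^{-d}`. The total error `2 / e^d` lies within the stated `4 / e^d`.
-/
theorem IsTracelessFamily.chiSqDiv_hardMixture_le (hV : IsTracelessFamily V) (hc : 0 < c)
    (hε : 0 < ε) (hcε : 24 * c * ε ≤ 1) (hd : d ≠ 0) (hℓ : (d : ℝ) ^ 2 / 2 ≤ ℓ) (n : ℕ) :
    chiSqDiv (hardMixture c ε V n) (tensorPow n (maxMixed d))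
      ≤ ((Real.exp (n ^ 2 * c ^ 4 * ε ^ 4 / (2 * ℓ)) - 1 + 4 / Real.exp d : ℝ) : EReal) := by
  rw [hV.chiSqDiv_hardMixture hd, EReal.coe_le_coe_iff]
  have hℓ0 : (0 : ℝ) < ℓ := lt_of_lt_of_le (by positivity) hℓ
  set P : ℝ := 2 ^ ℓ with hP
  have hP0 : 0 < P := by positivity
  have hcardP : ((Fintype.card (Fin ℓ → ℤˣ) : ℕ) : ℝ) = P := by
    simp [hP]
  set E : ℝ := Real.exp (n ^ 2 * c ^ 4 * ε ^ 4 / (2 * ℓ)) with hE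
  let bad : (Fin ℓ → ℤˣ) → ℝ := fun z =>
    if 16 * √(d : ℝ) < opNorm (∑ i, (((z i : ℤˣ) : ℤ) : ℂ) • V i) then 1 else 0
  have hbad : ∑ z, bad z ≤ P * Real.exp (-d) := by
    have := card_opNorm_gt_le V hV.orthonormal
    simpa only [bad, Finset.sum_boole] using this
  have hmom : ∀ z : Fin ℓ → ℤˣ, ∑ w : Fin ℓ → ℤˣ, Real.exp (n * (c ^ 2 * ε ^ 2 / ℓ) *
      ∑ i, (((w i : ℤˣ) : ℤ) : ℝ) * (((z i : ℤˣ) : ℤ) : ℝ)) ≤ P * E := by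
    intro z
    refine (sum_exp_signs_le _ fun i => (((z i : ℤˣ) : ℤ) : ℝ)).trans_eq ?_
    have hz : ∑ i, (((z i : ℤˣ) : ℤ) : ℝ) ^ 2 = ℓ := by
      simp [sq, ← Int.cast_mul, ← Units.val_mul]
    rw [hz, hE]
    congr 2
    field_simp
  have hsum : ∑ z : Fin ℓ → ℤˣ, ∑ w : Fin ℓ → ℤˣ,
      (d * (hardState c ε V z * hardState c ε V w).trace.re) ^ n
      ≤ P * (P * (E + 2 * Real.exp (-d))) := by
    calc _ ≤ ∑ z : Fin ℓ → ℤˣ, ∑ w : Fin ℓ → ℤˣ, (Real.exp (n * (c ^ 2 * ε ^ 2 / ℓ) *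
          ∑ i, (((w i : ℤˣ) : ℤ) : ℝ) * (((z i : ℤˣ) : ℤ) : ℝ)) + bad z + bad w) :=
        Finset.sum_le_sum fun z _ => Finset.sum_le_sum fun w _ =>
          hV.overlap_pow_le hc hε hcε hd hℓ n z w
      _ ≤ ∑ z : Fin ℓ → ℤˣ, (P * E + P * bad z + P * Real.exp (-d)) := by
        refine Finset.sum_le_sum fun z _ => ?_
        rw [Finset.sum_add_distrib, Finset.sum_add_distrib, Finset.sum_const, Finset.card_univ,
          nsmul_eq_mul, hcardP]
        exact add_le_add (add_le_add_left (hmom z) _) hbad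
      _ ≤ P * (P * E) + P * (P * Real.exp (-d)) + P * (P * Real.exp (-d)) := by
        rw [Finset.sum_add_distrib, Finset.sum_add_distrib, Finset.sum_const, Finset.sum_const,
          Finset.card_univ, nsmul_eq_mul, nsmul_eq_mul, hcardP, ← Finset.mul_sum]
        gcongr
      _ = _ := by ring
  have hmain : P⁻¹ * (P⁻¹ * ∑ z : Fin ℓ → ℤˣ, ∑ w : Fin ℓ → ℤˣ,
      (d * (hardState c ε V z * hardState c ε V w).trace.re) ^ n) ≤ E + 2 * Real.exp (-d) := by
    calc _ ≤ P⁻¹ * (P⁻¹ * (P * (P * (E + 2 * Real.exp (-d))))) := by gcongr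
      _ = _ := by field_simp
  have : 4 / Real.exp d = 4 * Real.exp (-d) := by rw [Real.exp_neg, div_eq_mul_inv]
  rw [this]
  linarith [Real.exp_pos (-d)]

theorem four_div_exp_le {d : ℕ} (hd : 6 ≤ d) : 4 / Real.exp d ≤ 1 / 64 := by
  have h : (256 : ℝ) ≤ Real.exp d := by
    have h1 := Real.exp_one_gt_d9
    calc (256 : ℝ) ≤ 2.7 ^ 6 := by norm_num
      _ ≤ Real.exp 1 ^ 6 := by gcongr; linarith
      _ = Real.exp 6 := by rw [← Real.exp_nat_mul]; norm_num
      _ ≤ Real.exp d := Real.exp_le_exp.2 (by exact_mod_cast hd)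
  rw [div_le_div_iff₀ (Real.exp_pos _) (by norm_num)]
  linarith

/-- The bound on `n` makes the exponent at most `1/32`, so the divergence is at most `1/31 + 1/64 <
1/16`. -/
theorem IsTracelessFamily.chiSqDiv_hardMixture_lt (hV : IsTracelessFamily V) (hc : 0 < c)
    (hε : 0 < ε) (hcε : 24 * c * ε ≤ 1) (hd : 6 ≤ d) (hℓ : (d : ℝ) ^ 2 / 2 ≤ ℓ) {n : ℕ}
    (hn : (n : ℝ) < 1 / (4 * c ^ 2) * (√(ℓ : ℝ) / ε ^ 2)) :
    chiSqDiv (hardMixture c ε V n) (tensorPow n (maxMixed d)) < ((1 / 16 : ℝ) : EReal) := by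
  have hd0 : d ≠ 0 := by omega
  have hℓ0 : (0 : ℝ) < ℓ := lt_of_lt_of_le (by positivity) hℓ
  refine (hV.chiSqDiv_hardMixture_le hc hε hcε hd0 hℓ n).trans_lt ?_
  rw [EReal.coe_lt_coe_iff]
  have h1 : (n : ℝ) ^ 2 * c ^ 4 * ε ^ 4 / (2 * ℓ) ≤ 1 / 32 := by
    have h2 : (n : ℝ) ^ 2 ≤ (1 / (4 * c ^ 2) * (√(ℓ : ℝ) / ε ^ 2)) ^ 2 := by gcongr
    have h3 : (1 / (4 * c ^ 2) * (√(ℓ : ℝ) / ε ^ 2)) ^ 2 = ℓ / (16 * c ^ 4 * ε ^ 4) := by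
      rw [mul_pow, div_pow, div_pow, Real.sq_sqrt hℓ0.le]
      field_simp
      norm_num
    rw [h3] at h2
    calc _ ≤ ℓ / (16 * c ^ 4 * ε ^ 4) * c ^ 4 * ε ^ 4 / (2 * ℓ) := by gcongr
      _ = 1 / 32 := by field_simp; norm_num
  have h2 : Real.exp (n ^ 2 * c ^ 4 * ε ^ 4 / (2 * ℓ)) ≤ 32 / 31 := by
    refine (Real.exp_le_exp.2 h1).trans ?_
    have := Real.one_sub_le_exp_neg (1 / 32)
    rw [Real.exp_neg] at this
    rw [show (32 / 31 : ℝ) = (1 - 1 / 32)⁻¹ by norm_num]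
    exact (le_inv_comm₀ (by norm_num) (Real.exp_pos _)).1 this
  linarith [four_div_exp_le hd]

end Mixture

/-! ### Existence of perturbation bases. -/

/-- The isometry `S + A ↦ S + iA` (`S` symmetric, `A` antisymmetric) from real matrices onto
Hermitian matrices. -/
noncomputable def hermitianOfReal {d : ℕ} (x : EuclideanSpace ℝ (Fin d × Fin d)) :
    Matrix (Fin d) (Fin d) ℂ :=
  Matrix.of fun i j => ((1 + Complex.I) * (x (i, j) : ℂ) + (1 - Complex.I) * (x (j, i) : ℂ)) / 2

theorem isHermitian_hermitianOfReal {d : ℕ} (x : EuclideanSpace ℝ (Fin d × Fin d)) :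
    (hermitianOfReal x).IsHermitian := by
  ext i j
  simp [hermitianOfReal]
  ring

/-- The imaginary terms cancel under exchanging `i` and `j`. Real orthonormal bases are thereby
carried to Hermitian orthonormal families. -/
theorem trace_hermitianOfReal_mul {d : ℕ} (x y : EuclideanSpace ℝ (Fin d × Fin d)) :
    ((hermitianOfReal x)ᴴ * hermitianOfReal y).trace = ((inner ℝ x y : ℝ) : ℂ) := by
  have h1 : ((hermitianOfReal x)ᴴ * hermitianOfReal y).trace
      = ∑ i, ∑ j, ((x (i, j) * y (i, j) + x (j, i) * y (j, i) : ℂ) / 2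
        + Complex.I / 2 * (x (i, j) * y (j, i)) - Complex.I / 2 * (x (j, i) * y (i, j))) := by
    rw [(isHermitian_hermitianOfReal x).eq, Matrix.trace]
    refine Finset.sum_congr rfl fun i _ => ?_
    rw [Matrix.diag_apply, Matrix.mul_apply]
    refine Finset.sum_congr rfl fun j _ => ?_
    simp only [hermitianOfReal, Matrix.of_apply]
    ring_nf
    simp only [Complex.I_sq]
    ring
  have h2 : ∀ f : Fin d → Fin d → ℂ, ∑ i, ∑ j, f j i = ∑ i, ∑ j, f i j :=
    fun f => Finset.sum_comm
  have h3 : ((inner ℝ x y : ℝ) : ℂ) = ∑ i, ∑ j, (x (i, j) : ℂ) * y (i, j) := by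
    simp [PiLp.inner_apply, Fintype.sum_prod_type, mul_comm]
  rw [h1, h3]
  simp only [Finset.sum_sub_distrib, Finset.sum_add_distrib, ← Finset.sum_div, ← Finset.mul_sum]
  rw [h2 fun i j => (x (i, j) : ℂ) * y (i, j), h2 fun i j => (x (i, j) : ℂ) * y (j, i)]
  ring

/-- Perturbation bases exist in every dimension. -/
theorem exists_isPerturbationBasis {d : ℕ} (hd : d ≠ 0) :
    ∃ V : Fin (d ^ 2) → Matrix (Fin d) (Fin d) ℂ, IsPerturbationBasis V := by
  have hd' : (0 : ℝ) < d := by positivity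
  have hpos : 0 < d ^ 2 := by positivity
  -- The preimage of `𝟙 / √d`, prescribed below as the last vector of a real orthonormal basis.
  let e : EuclideanSpace ℝ (Fin d × Fin d) :=
    WithLp.toLp 2 fun p => if p.1 = p.2 then (√(d : ℝ))⁻¹ else 0
  have he : ‖e‖ = 1 := by
    rw [← sq_eq_sq₀ (norm_nonneg _) zero_le_one, EuclideanSpace.norm_sq_eq]
    simp only [e, Fintype.sum_prod_type]
    simp [apply_ite, hd'.ne']
  let s : Set (Fin (d ^ 2)) := {⟨d ^ 2 - 1, by omega⟩}
  have hs : Orthonormal ℝ (s.domRestrict fun _ => e) := by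
    refine ⟨fun _ => he, fun i j hij => absurd (Subsingleton.elim i j) hij⟩
  obtain ⟨b, hb⟩ := hs.exists_orthonormalBasis_extension_of_card_eq (by simp [sq])
  refine ⟨fun i => hermitianOfReal (b i), fun i => isHermitian_hermitianOfReal _, fun i j => ?_,
    fun i hi => ?_⟩
  · rw [trace_hermitianOfReal_mul, orthonormal_iff_ite.1 b.orthonormal i j]
    split_ifs <;> simp
  · have hi' : i ∈ s := Fin.ext (by simp only; omega)
    rw [hb i hi']
    ext j k
    by_cases hjk : j = k
    · subst hjk
      simp [hermitianOfReal, e]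
      ring
    · simp [hermitianOfReal, e, hjk, Ne.symm hjk]

/-! ### Hölder's inequality for Schatten norms. -/

theorem abs_eigenvalues_le_opNorm {d : ℕ} {H : Matrix (Fin d) (Fin d) ℂ} (hH : H.IsHermitian)
    (j : Fin d) : |hH.eigenvalues j| ≤ opNorm H := by
  have h2 : toEuclideanCLM (n := Fin d) (𝕜 := ℂ) H (hH.eigenvectorBasis j)
      = ((hH.eigenvalues j : ℝ) : ℂ) • hH.eigenvectorBasis j := by
    apply WithLp.ofLp_injective
    rw [Matrix.ofLp_toEuclideanCLM, WithLp.ofLp_smul, hH.mulVec_eigenvectorBasis j, Complex.coe_smul]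
  have h3 := (toEuclideanCLM (n := Fin d) (𝕜 := ℂ) H).le_opNorm (hH.eigenvectorBasis j)
  rwa [h2, norm_smul, hH.eigenvectorBasis.norm_eq_one, mul_one, mul_one, Complex.norm_real,
    Real.norm_eq_abs] at h3

open scoped Matrix.Norms.L2Operator in
theorem opNorm_conjTranspose_mul_self {d : ℕ} (A : Matrix (Fin d) (Fin d) ℂ) :
    opNorm (Aᴴ * A) = opNorm A * opNorm A := by
  exact Matrix.l2_opNorm_conjTranspose_mul_self A

/-- Hölder's inequality `‖A‖₂² ≤ ‖A‖_∞ ‖A‖₁` for Schatten norms. -/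
theorem trace_conjTranspose_mul_self_le {d : ℕ} (A : Matrix (Fin d) (Fin d) ℂ) :
    (Aᴴ * A).trace.re ≤ opNorm A * traceNorm A := by
  have hH := Matrix.isHermitian_conjTranspose_mul_self A
  have h0 := (Matrix.posSemidef_conjTranspose_mul_self A).eigenvalues_nonneg
  rw [hH.trace_eq_sum_eigenvalues, traceNorm, Finset.mul_sum, Complex.re_sum]
  refine Finset.sum_le_sum fun i _ => ?_
  have h1 : √(hH.eigenvalues i) ≤ opNorm A := by
    rw [Real.sqrt_le_left (opNorm_nonneg A), sq, ← opNorm_conjTranspose_mul_self]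
    exact (le_abs_self _).trans (abs_eigenvalues_le_opNorm hH i)
  calc ((hH.eigenvalues i : ℝ) : ℂ).re = √(hH.eigenvalues i) * √(hH.eigenvalues i) := by
        rw [Complex.ofReal_re, Real.mul_self_sqrt (h0 i)]
    _ ≤ opNorm A * √(hH.eigenvalues i) := by gcongr

/-! ### The lower bound for mixedness testing. -/

section LowerBound

variable {d ℓ : ℕ} {c ε : ℝ} {V : Fin ℓ → Matrix (Fin d) (Fin d) ℂ}

/-- For typical `z` nothing is truncated, and Hölder gives `c² ε² / d ≤ (24 c ε / d) ‖Δ_z‖₁`. At `c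
= 24` the distance reaches `ε`. -/
theorem IsTracelessFamily.le_traceNorm (hV : IsTracelessFamily V) (hc : 0 < c) (hε : 0 < ε)
    (hcε : 24 * c * ε ≤ 1) (hd : d ≠ 0) (hℓ : (d : ℝ) ^ 2 / 2 ≤ ℓ) {z : Fin ℓ → ℤˣ}
    (hz : opNorm (∑ i, (((z i : ℤˣ) : ℤ) : ℂ) • V i) ≤ 16 * √(d : ℝ)) :
    c * ε / 24 ≤ traceNorm (hardState c ε V z - maxMixed d) := by
  have hd' : (0 : ℝ) < d := by positivity
  have hℓ0 : (0 : ℝ) < ℓ := lt_of_lt_of_le (by positivity) hℓ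
  have h1 : hardState c ε V z - maxMixed d = perturbation c ε V z := by
    rw [hardState, add_sub_cancel_left, truncPerturbation_eq,
      hV.truncFactor_eq_one hc hε hcε hd hℓ hz, Complex.ofReal_one, one_smul]
  have h2 := trace_conjTranspose_mul_self_le (perturbation c ε V z)
  have hzz : ∑ i, (((z i : ℤˣ) : ℤ) : ℝ) * (((z i : ℤˣ) : ℤ) : ℝ) = ℓ := by
    simp [← Int.cast_mul, ← Units.val_mul]
  rw [(hV.isHermitian_perturbation c ε z).eq, hV.trace_perturbation_mul, Complex.ofReal_re,
    hzz] at h2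
  have h3 := opNorm_perturbation_le hc.le hε.le hd hℓ hz
  have h4 : 0 ≤ traceNorm (perturbation c ε V z) := Finset.sum_nonneg fun _ _ => Real.sqrt_nonneg _
  rw [h1]
  have h5 : c ^ 2 * ε ^ 2 / (d * ℓ) * ℓ ≤ 24 * c * ε / d * traceNorm (perturbation c ε V z) :=
    h2.trans (by gcongr)
  have h6 : c ^ 2 * ε ^ 2 / (d * ℓ) * ℓ = 24 * c * ε / d * (c * ε / 24) := by field_simp
  rw [h6] at h5
  exact le_of_mul_le_mul_left h5 (by positivity)

theorem IsTracelessFamily.isHermitian_hardMixture (hV : IsTracelessFamily V) (hd : d ≠ 0) (n : ℕ) :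
    (hardMixture c ε V n).IsHermitian := by
  rw [Matrix.IsHermitian, hardMixture, Matrix.conjTranspose_smul, Matrix.conjTranspose_sum]
  congr 1
  · simp
  · exact Finset.sum_congr rfl fun z _ =>
      ((hV.isState_hardState c ε hd z).tensorPow n).1.isHermitian.eq

/-- A successful test rejects the average state of the ensemble. -/
theorem IsTracelessFamily.reject_hardMixture (hV : IsTracelessFamily V) (hε : 0 < ε)
    (hcε : 24 * 24 * ε ≤ 1) (hd : d ≠ 0) (hℓ : (d : ℝ) ^ 2 / 2 ≤ ℓ) {n : ℕ}
    {T : Matrix (Fin n → Fin d) (Fin n → Fin d) ℂ} (hT : Certifies T (maxMixed d) ε (1 / 4)) :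
    3 / 4 - 3 / 4 * Real.exp (-d) ≤ ((1 - T) * hardMixture 24 ε V n).trace.re := by
  let bad : (Fin ℓ → ℤˣ) → ℝ := fun z =>
    if 16 * √(d : ℝ) < opNorm (∑ i, (((z i : ℤˣ) : ℤ) : ℂ) • V i) then 1 else 0
  have hbad : ∑ z, bad z ≤ 2 ^ ℓ * Real.exp (-d) := by
    have := card_opNorm_gt_le V hV.orthonormal
    simpa only [bad, Finset.sum_boole] using this
  have hterm : ∀ z, 3 / 4 - 3 / 4 * bad z
      ≤ ((1 - T) * tensorPow n (hardState 24 ε V z)).trace.re := by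
    intro z
    have hstate := hV.isState_hardState 24 ε hd z
    by_cases hz : 16 * √(d : ℝ) < opNorm (∑ i, (((z i : ℤˣ) : ℤ) : ℂ) • V i)
    · simp only [bad, if_pos hz, mul_one, sub_self]
      exact trace_mul_re_nonneg hT.2.1 (hstate.tensorPow n).1
    · simp only [bad, if_neg hz, mul_zero, sub_zero]
      have h := hV.le_traceNorm (by norm_num) hε hcε hd hℓ (not_lt.1 hz)
      rw [mul_div_cancel_left₀ ε (by norm_num)] at h
      exact le_trans (by norm_num) (hT.2.2.2 _ hstate h)
  have hsum : ((1 - T) * hardMixture 24 ε V n).trace.re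
      = ((2 : ℝ) ^ ℓ)⁻¹ * ∑ z, ((1 - T) * tensorPow n (hardState 24 ε V z)).trace.re := by
    rw [hardMixture, Matrix.mul_smul, Matrix.trace_smul, Matrix.mul_sum, Matrix.trace_sum,
      smul_eq_mul, show ((2 : ℂ) ^ ℓ)⁻¹ = ((((2 : ℝ) ^ ℓ)⁻¹ : ℝ) : ℂ) by push_cast; rfl,
      Complex.re_ofReal_mul, Complex.re_sum]
  have hcard : ((Fintype.card (Fin ℓ → ℤˣ) : ℕ) : ℝ) = 2 ^ ℓ := by simp
  have hlow : (2 : ℝ) ^ ℓ * (3 / 4 - 3 / 4 * Real.exp (-d))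
      ≤ ∑ z, ((1 - T) * tensorPow n (hardState 24 ε V z)).trace.re := by
    refine le_trans ?_ (Finset.sum_le_sum fun z _ => hterm z)
    rw [Finset.sum_sub_distrib, Finset.sum_const, Finset.card_univ, nsmul_eq_mul, hcard,
      ← Finset.mul_sum]
    linarith
  rw [hsum]
  calc _ = ((2 : ℝ) ^ ℓ)⁻¹ * (2 ^ ℓ * (3 / 4 - 3 / 4 * Real.exp (-d))) := by field_simp
    _ ≤ _ := by gcongr

/-- A measurement operator distinguishes a state from the maximally mixed one with bias at most
`1/4` if their `χ²`-divergence is below `1/16`. -/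
theorem trace_mul_sub_lt_of_chiSqDiv_lt {n : ℕ} (hd : d ≠ 0)
    {T M : Matrix (Fin n → Fin d) (Fin n → Fin d) ℂ} (hT : T.PosSemidef)
    (hT1 : (1 - T).PosSemidef) (hM : M.IsHermitian) (hM1 : M.trace = 1)
    (hχ : chiSqDiv M (tensorPow n (maxMixed d)) < ((1 / 16 : ℝ) : EReal)) :
    (T * tensorPow n (maxMixed d)).trace.re - (T * M).trace.re < 1 / 4 := by
  rw [chiSqDiv_tensorPow_maxMixed hd M hM1, EReal.coe_lt_coe_iff] at hχ
  set D : ℝ := (d : ℝ) ^ n with hD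
  have hD0 : 0 < D := by positivity
  have hTT : (T * T).trace.re ≤ T.trace.re := by
    have h := trace_mul_re_nonneg hT hT1
    rw [Matrix.mul_sub, mul_one, Matrix.trace_sub, Complex.sub_re] at h
    linarith
  have hTD : T.trace.re ≤ D := by
    have h := (Complex.le_def.1 hT1.trace_nonneg).1
    have h1 : (1 : Matrix (Fin n → Fin d) (Fin n → Fin d) ℂ).trace = (D : ℂ) := by
      simp [hD, Matrix.trace_one]
    rw [Matrix.trace_sub, h1, Complex.sub_re, Complex.ofReal_re, Complex.zero_re] at h
    linarith
  rw [tensorPow_maxMixed, ← hD]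
  set σ : Matrix (Fin n → Fin d) (Fin n → Fin d) ℂ := ((D⁻¹ : ℝ) : ℂ) • 1 with hσ
  -- Cauchy–Schwarz by completing the square: `tr ((M - σ) + s T)² ≥ 0`. After multiplication by
  -- `D`, this `s` bounds both quadratic terms by `1/16` and gives the bias the factor `1/2`.
  set s : ℝ := D⁻¹ / 4 with hs
  have hσH : σ.IsHermitian := by
    rw [hσ, Matrix.IsHermitian, Matrix.conjTranspose_smul, Matrix.conjTranspose_one]
    simp
  have hsT : ((s : ℂ) • T).IsHermitian := by
    rw [Matrix.IsHermitian, Matrix.conjTranspose_smul, hT.isHermitian.eq]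
    simp
  have hY : ((M - σ) + (s : ℂ) • T).IsHermitian := (hM.sub hσH).add hsT
  have hpos : 0 ≤ (((M - σ) + (s : ℂ) • T) * ((M - σ) + (s : ℂ) • T)).trace.re := by
    have h := (Matrix.posSemidef_conjTranspose_mul_self ((M - σ) + (s : ℂ) • T)).trace_nonneg
    rw [hY.eq] at h
    exact (Complex.le_def.1 h).1
  have hsq : ((M - σ) * (M - σ)).trace.re = (M * M).trace.re - D⁻¹ := by
    have hDc : (D : ℂ) ≠ 0 := Complex.ofReal_ne_zero.2 hD0.ne'
    have h1 : (1 : Matrix (Fin n → Fin d) (Fin n → Fin d) ℂ).trace = (D : ℂ) := by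
      simp [hD, Matrix.trace_one]
    have : ((M - σ) * (M - σ)).trace = (M * M).trace - ((D⁻¹ : ℝ) : ℂ) := by
      simp only [hσ, Matrix.sub_mul, Matrix.mul_sub, Matrix.smul_mul, Matrix.mul_smul, one_mul,
        mul_one, Matrix.trace_sub, Matrix.trace_smul, hM1, h1, smul_eq_mul]
      push_cast
      field_simp
      ring
    rw [this, Complex.sub_re, Complex.ofReal_re]
  have hexp : (((M - σ) + (s : ℂ) • T) * ((M - σ) + (s : ℂ) • T)).trace.re
      = ((M * M).trace.re - D⁻¹) + 2 * s * ((T * M).trace.re - (T * σ).trace.re)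
        + s ^ 2 * (T * T).trace.re := by
    have : (((M - σ) + (s : ℂ) • T) * ((M - σ) + (s : ℂ) • T)).trace
        = ((M - σ) * (M - σ)).trace + ((2 * s : ℝ) : ℂ) * ((T * M).trace - (T * σ).trace)
          + ((s ^ 2 : ℝ) : ℂ) * (T * T).trace := by
      rw [add_mul, mul_add, mul_add]
      simp only [Matrix.trace_add, Matrix.smul_mul, Matrix.mul_smul, Matrix.trace_smul,
        smul_eq_mul]
      rw [Matrix.trace_mul_comm (M - σ) T, Matrix.mul_sub T, Matrix.trace_sub]
      push_cast
      ring
    rw [this, Complex.add_re, Complex.add_re, Complex.re_ofReal_mul, Complex.re_ofReal_mul,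
      Complex.sub_re, hsq]
  rw [hexp] at hpos
  have e1 : D * ((M * M).trace.re - D⁻¹) < 1 / 16 := by
    rw [mul_sub, mul_inv_cancel₀ hD0.ne']
    exact hχ
  have e2 : D * (s ^ 2 * (T * T).trace.re) ≤ 1 / 16 := by
    calc _ ≤ D * (s ^ 2 * D) := by gcongr; exact hTT.trans hTD
      _ = 1 / 16 := by rw [hs]; field_simp; norm_num
  have e3 : D * (2 * s * ((T * M).trace.re - (T * σ).trace.re))
      = ((T * M).trace.re - (T * σ).trace.re) / 2 := by
    rw [hs]
    field_simp
    norm_num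
  have e4 := mul_nonneg hD0.le hpos
  rw [mul_add, mul_add, e3] at e4
  linarith

/-- Sample complexity of mixedness testing. -/
theorem Certifies.le_samples {n : ℕ} {T : Matrix (Fin n → Fin d) (Fin n → Fin d) ℂ}
    (hT : Certifies T (maxMixed d) ε (1 / 4)) (hd : 6 ≤ d) (hε : 0 < ε) (hcε : 24 * 24 * ε ≤ 1) :
    1 / (6 * 24 ^ 2) * (d / ε ^ 2) ≤ n := by
  have hd0 : d ≠ 0 := by omega
  have hd6 : (6 : ℝ) ≤ d := by exact_mod_cast hd
  obtain ⟨V, hV⟩ := exists_isPerturbationBasis hd0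
  -- All `d² - 1` traceless directions are used, so that `√ℓ` is of order `d`.
  have hlt : d ^ 2 - 1 < d ^ 2 := Nat.sub_lt (by positivity) one_pos
  have hV' := hV.isTracelessFamily hd0 hlt
  have hcast : ((d ^ 2 - 1 : ℕ) : ℝ) = (d : ℝ) ^ 2 - 1 := by
    rw [Nat.cast_sub (by nlinarith)]
    push_cast
    rfl
  have hℓ : (d : ℝ) ^ 2 / 2 ≤ ((d ^ 2 - 1 : ℕ) : ℝ) := by
    rw [hcast]
    nlinarith
  have hsl : 2 / 3 * (d : ℝ) ≤ √((d ^ 2 - 1 : ℕ) : ℝ) := Real.le_sqrt_of_sq_le (by nlinarith)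
  by_contra! hn
  have hn' : (n : ℝ) < 1 / (4 * 24 ^ 2) * (√((d ^ 2 - 1 : ℕ) : ℝ) / ε ^ 2) := by
    refine hn.trans_le ?_
    calc 1 / (6 * 24 ^ 2) * (d / ε ^ 2) = 1 / (4 * 24 ^ 2) * (2 / 3 * (d : ℝ) / ε ^ 2) := by ring
      _ ≤ _ := by gcongr
  have hχ := hV'.chiSqDiv_hardMixture_lt (by norm_num) hε hcε hd hℓ hn'
  have h1 := trace_mul_sub_lt_of_chiSqDiv_lt hd0 hT.1 hT.2.1
    (hV'.isHermitian_hardMixture hd0 n) (hV'.trace_hardMixture hd0 n) hχ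
  have h2 := hV'.reject_hardMixture hε hcε hd0 hℓ hT
  have h3 := hT.2.2.1
  rw [Matrix.sub_mul, one_mul, Matrix.trace_sub, hV'.trace_hardMixture hd0 n, Complex.sub_re,
    Complex.one_re] at h2
  -- The acceptance probabilities differ by at least `1/2 - (3/4) e^{-d}`, which exceeds `1/4`.
  have h4 := four_div_exp_le hd
  rw [div_eq_mul_inv, ← Real.exp_neg] at h4
  linarith

end LowerBound

end MixednessTesting

open MixednessTesting in
theorem mainTheorem6 :
    (∀ c : ℝ, 0 < c → ∃ C : ℝ, 0 < C ∧ ∃ κ : ℝ, 0 < κ ∧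
      ∀ (d ℓ : ℕ) (_ : 6 ≤ d) (_ : (d : ℝ) ^ 2 / 2 ≤ ℓ) (hℓ : ℓ < d ^ 2)
        (V : Fin (d ^ 2) → Matrix (Fin d) (Fin d) ℂ) (_ : IsPerturbationBasis V)
        (ε : ℝ) (_ : 0 < ε) (_ : ε < C) (n : ℕ),
        chiSqDiv (hardMixture c ε (fun i => V (Fin.castLE hℓ.le i)) n) (tensorPow n (maxMixed d))
            ≤ ((Real.exp (n ^ 2 * c ^ 4 * ε ^ 4 / (2 * ℓ)) - 1 + 4 / Real.exp d : ℝ) : EReal) ∧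
        ((n : ℝ) < κ * (√(ℓ : ℝ) / ε ^ 2) →
          chiSqDiv (hardMixture c ε (fun i => V (Fin.castLE hℓ.le i)) n) (tensorPow n (maxMixed d))
            < ((1 / 16 : ℝ) : EReal))) ∧
    (∃ C : ℝ, 0 < C ∧ ∃ κ : ℝ, 0 < κ ∧
      ∀ (d : ℕ) (_ : 6 ≤ d) (ε : ℝ) (_ : 0 < ε) (_ : ε < C) (n : ℕ)
        (T : Matrix (Fin n → Fin d) (Fin n → Fin d) ℂ),
        Certifies T (maxMixed d) ε (1 / 4) → κ * (d / ε ^ 2) ≤ n) := by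
  constructor
  · intro c hc
    refine ⟨1 / (24 * c), by positivity, 1 / (4 * c ^ 2), by positivity, ?_⟩
    intro d ℓ hd hdℓ hℓ V hV ε hε hεC n
    have hd0 : d ≠ 0 := by omega
    have hV' := hV.isTracelessFamily hd0 hℓ
    have hcε : 24 * c * ε ≤ 1 := by
      rw [lt_div_iff₀ (by positivity)] at hεC
      linarith
    exact ⟨hV'.chiSqDiv_hardMixture_le hc hε hcε hd0 hdℓ n,
      hV'.chiSqDiv_hardMixture_lt hc hε hcε hd hdℓ⟩
  -- `576 = 24 · 24` is the no-truncation condition at `c = 24`; the `6` is `4 / (2/3)`, from `√(d²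
  -- - 1) ≥ 2d/3`.
  · refine ⟨1 / 576, by norm_num, 1 / (6 * 24 ^ 2), by norm_num, ?_⟩
    intro d hd ε hε hεC n T hT
    exact hT.le_samples hd hε (by linarith)
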